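/- Fix $\nu>0$. For every real $\beta$ let $\mathbb P_\beta(W=\cdot)$ be a probability law on $\mathbb Z$, put $p_\beta := 1-\mathbb P_\beta(W=0)$, and assume that, as $\beta\to\infty$: - for all sufficiently large $\beta$ the law is symmetric: $\mathbb P_\beta(W=z)=\mathbb P_\beta(W=-z)$ for all $z\in\mathbb Z$; - $p_\beta$ is of the exact order $e^{-\beta}$, that is, there are constants $0<a\le A<\infty$ with $a\,e^{-\beta}\le p_\beta\le A\,e^{-\beta}$ for all sufficiently large $\beta$; moreover $\mathbb P_\beta(W=\pm1)=O(e^{-\beta})$; - for all sufficiently large $\beta$, $\mathbb P_\beta(W=z)\le p_\beta\,e^{-\nu\beta|z|}$ for every integer $z\ne 0,\pm1$. For $z\in\mathbb Z$ let $\mathbb P_{\beta,z}$ be the law of the random walk $Z_k=z+W_1+\dots+W_k$, $k\ge 0$, where $W_1,W_2,\dots$ are i.i.d. with the law $\mathbb P_\beta(W=\cdot)$, let $\mathbb E_{\beta,z}$ be the expectation, and let $\mathcal R_+^n=\{Z_k\ge 0 \text{ for } k=0,1,\dots,n\}$. If $\chi>1/2$, then $$\lim_{\beta\to\infty} e^{-2\chi\beta}\,\sup_{z\in\mathbb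 Z,\ z\ge 0}\ \sum_{n\ge 0}\mathbb E_{\beta,z}\big[e^{-\nu\beta Z_n};\,\mathcal R_+^n\big]=0$$ (in particular the supremum is finite for all sufficiently large $\beta$). Consequently, for every constant $c_1\ge 0$ that does not depend on $\beta$, the inequality $$c_1\,e^{-2\chi\beta}\,\sup_{z\in\mathbb Z,\ z\ge 0}\ \sum_{n\ge 0}\mathbb E_{\beta,z}\big[e^{-\nu\beta Z_n};\,\mathcal R_+^n\big]<1$$ holds for all sufficiently large $\beta$. -/

import Mathlib

open MeasureTheory Filter Topology Asymptotics
open scoped ENNReal NNReal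

namespace EffectiveWalk

/-- `p = 1 - P(W = 0)`, for a step `W` with law `q`. -/
noncomputable def moveProb (q : Measure ℤ) : ℝ :=
  1 - q.real {0}

/-- The family `q β` of symmetric laws on `ℤ` (the law of the step `W` at inverse temperature `β`)
satisfies: `p_β = 1 - P_β(W = 0)` is of the exact order `e^{-β}`, `P_β(W = ±1) = O(e^{-β})`, and
`P_β(W = z) ≤ p_β e^{-νβ|z|}` for `z ≠ 0, ±1`, for all large `β`. -/
structure IsEffectiveStepLaw (ν : ℝ) (q : ℝ → Measure ℤ) : Prop where
  symmetric : ∀ᶠ β in atTop, ∀ z : ℤ, (q β).real {-z} = (q β).real {z}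
  moveProb_isTheta : (fun β : ℝ => moveProb (q β)) =Θ[atTop] fun β : ℝ => Real.exp (-β)
  one_isBigO : (fun β : ℝ => (q β).real {1}) =O[atTop] fun β : ℝ => Real.exp (-β)
  neg_one_isBigO : (fun β : ℝ => (q β).real {-1}) =O[atTop] fun β : ℝ => Real.exp (-β)
  tail : ∀ᶠ β in atTop, ∀ z : ℤ, z ≠ 0 → z ≠ 1 → z ≠ -1 →
    (q β).real {z} ≤ moveProb (q β) * Real.exp (-(ν * β * |(z : ℝ)|))

/-- The trajectory `Z_k = z + w_0 + ... + w_{k-1}` started at `z` with steps `w`. -/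
def path (z : ℤ) (w : ℕ → ℤ) (k : ℕ) : ℤ :=
  z + ∑ i ∈ Finset.range k, w i

/-- The law, on trajectories, of the random walk `Z` started at `z` with i.i.d. steps of
law `q`. -/
noncomputable def walkLaw (q : Measure ℤ) [IsProbabilityMeasure q] (z : ℤ) : Measure (ℕ → ℤ) :=
  (Measure.infinitePi fun _ : ℕ => q).map (path z)

/-- The event that `Z_k ≥ 0` for `k = 0, 1, ..., n`. -/
def staysNonneg (n : ℕ) : Set (ℕ → ℤ) :=
  {Z | ∀ k ≤ n, 0 ≤ Z k}

/-- `E_z[e^{-a Z_n}; Z_k ≥ 0 for k = 0, ..., n]`, for the walk with step law `q`. -/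
noncomputable def killedExp (q : Measure ℤ) [IsProbabilityMeasure q] (a : ℝ) (z : ℤ) (n : ℕ) :
    ℝ≥0∞ :=
  ∫⁻ Z in staysNonneg n, ENNReal.ofReal (Real.exp (-(a * (Z n : ℝ)))) ∂(walkLaw q z)

/-- `sup_{z ≥ 0} ∑_{n ≥ 0} E_z[e^{-a Z_n}; Z_k ≥ 0 for k = 0, ..., n]`, with values
in `[0, ∞]`. -/
noncomputable def supSum (q : Measure ℤ) [IsProbabilityMeasure q] (a : ℝ) : ℝ≥0∞ :=
  ⨆ z : ℕ, ∑' n : ℕ, killedExp q a (z : ℤ) n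

/-- The map from steps to trajectories is measurable, so `walkLaw` is the intended image law. -/
theorem measurable_path (z : ℤ) : Measurable (path z) := by
  refine measurable_pi_lambda _ fun k => ?_
  unfold path
  fun_prop

end EffectiveWalk

/-! The sum over `n` is the Green potential of the walk killed below `0`, so it is dominated by any
`[0, ∞]`-valued `H` with `e^{-az} + E H(z + W) ≤ H z` for `z ≥ 0` (`tsum_killedExp_le`). Take `H = K
* profile`, bounded and concave. By symmetry the drift of `profile` averages its second differences,
all nonpositive; unit steps alone yield a loss of at least `q{1} 2^{-z} / 4`. With `K = 4 / q{1}`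
this pays for `e^{-az}` once `a ≥ log 2`, so the potential is at most `8 / q{1}` (`supSum_le`). The
tail bound forces `q{1} ≥ p / 4`, which is at least of order `e^{-β}`. Hence the supremum is
`O(e^β)`, and `2χ > 1` finishes. -/

namespace EffectiveWalk

/-! ### First-step analysis of the killed walk -/

/-- Prepend a step to a sequence of steps. -/
def consStep (p : ℤ × (ℕ → ℤ)) (k : ℕ) : ℤ :=
  Nat.casesOn k p.1 p.2

@[simp] theorem consStep_zero (p : ℤ × (ℕ → ℤ)) : consStep p 0 = p.1 := rfl

@[simp] theorem consStep_succ (p : ℤ × (ℕ → ℤ)) (k : ℕ) : consStep p (k + 1) = p.2 k := rfl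

theorem measurable_consStep : Measurable consStep := by
  refine measurable_pi_lambda _ fun k => ?_
  cases k with
  | zero => exact measurable_fst
  | succ k => exact (measurable_pi_apply k).comp measurable_snd

theorem path_consStep_zero (z : ℤ) (p : ℤ × (ℕ → ℤ)) : path z (consStep p) 0 = z := by
  simp [path]

theorem path_consStep_succ (z : ℤ) (p : ℤ × (ℕ → ℤ)) (k : ℕ) :
    path z (consStep p) (k + 1) = path (z + p.1) p.2 k := by
  simp only [path, Finset.sum_range_succ', consStep_zero, consStep_succ]
  ring

/-- An i.i.d. sequence is an independent first term followed by an i.i.d. sequence. -/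
theorem map_consStep (q : Measure ℤ) [IsProbabilityMeasure q] :
    (q.prod (Measure.infinitePi fun _ : ℕ => q)).map consStep
      = Measure.infinitePi fun _ : ℕ => q := by
  refine Measure.eq_infinitePi (fun _ : ℕ => q) fun s t ht => ?_
  classical
  -- Padding with `univ` turns `s` into an initial segment, from which coordinate `0` splits off.
  let t' : ℕ → Set ℤ := fun i => if i ∈ s then t i else Set.univ
  have ht' : ∀ i, MeasurableSet (t' i) := fun i => MeasurableSet.of_discrete
  obtain ⟨N, hN⟩ : ∃ N, s ⊆ Finset.range (N + 1) :=
    ⟨s.sup id, fun i hi => Finset.mem_range.2 (Nat.lt_succ_of_le (Finset.le_sup (f := id) hi))⟩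
  have hset : consStep ⁻¹' Set.pi s t
      = t' 0 ×ˢ Set.pi (Finset.range N) fun i => t' (i + 1) := by
    ext p
    simp only [Set.mem_preimage, Set.mem_pi, Set.mem_prod, Finset.mem_coe, t']
    constructor
    · intro h
      refine ⟨?_, fun i _ => ?_⟩
      · split_ifs with h0
        · exact h 0 h0
        · trivial
      · split_ifs with h0
        · exact h (i + 1) h0
        · trivial
    · rintro ⟨h0, h1⟩ i hi
      cases i with
      | zero => simpa [hi] using h0
      | succ i =>
        have := h1 i (by simpa using hN hi)
        simpa [hi] using this
  rw [Measure.map_apply measurable_consStep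
    (MeasurableSet.pi s.countable_toSet fun i _ => ht i), hset, Measure.prod_prod,
    Measure.infinitePi_pi _ (fun i _ => ht' (i + 1))]
  have h1 : ∏ i ∈ s, q (t i) = ∏ i ∈ Finset.range (N + 1), q (t' i) := by
    rw [← Finset.prod_subset hN]
    · exact Finset.prod_congr rfl fun i hi => by simp [t', hi]
    · intro i _ hi
      simp [t', hi]
  rw [h1, Finset.prod_range_succ', mul_comm]

theorem measurableSet_staysNonneg (n : ℕ) : MeasurableSet (staysNonneg n) := by
  have : staysNonneg n = ⋂ k ∈ Finset.range (n + 1), {Z : ℕ → ℤ | 0 ≤ Z k} := by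
    ext Z
    simp [staysNonneg]
  rw [this]
  exact Finset.measurableSet_biInter _ fun k _ =>
    measurableSet_le measurable_const (measurable_pi_apply k)

/-- The weight `e^{-a Z_n}` on the event that the trajectory stays nonnegative up to time `n`. -/
noncomputable def killedWeight (a : ℝ) (n : ℕ) : (ℕ → ℤ) → ℝ≥0∞ :=
  (staysNonneg n).indicator fun Z => ENNReal.ofReal (Real.exp (-(a * (Z n : ℝ))))

theorem measurable_killedWeight (a : ℝ) (n : ℕ) : Measurable (killedWeight a n) := by
  refine Measurable.indicator ?_ (measurableSet_staysNonneg n)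
  have : Measurable fun m : ℤ => ENNReal.ofReal (Real.exp (-(a * (m : ℝ)))) := measurable_from_top
  exact this.comp (measurable_pi_apply n)

theorem killedExp_eq (q : Measure ℤ) [IsProbabilityMeasure q] (a : ℝ) (z : ℤ) (n : ℕ) :
    killedExp q a z n
      = ∫⁻ w, killedWeight a n (path z w) ∂(Measure.infinitePi fun _ : ℕ => q) := by
  rw [killedExp, ← lintegral_indicator (measurableSet_staysNonneg n), walkLaw]
  exact lintegral_map (measurable_killedWeight a n) (measurable_path z)

theorem killedExp_of_neg (q : Measure ℤ) [IsProbabilityMeasure q] (a : ℝ) {z : ℤ} (hz : z < 0)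
    (n : ℕ) : killedExp q a z n = 0 := by
  rw [killedExp_eq, ← lintegral_zero]
  refine lintegral_congr fun w => ?_
  refine Set.indicator_of_notMem (fun h => ?_) _
  have := h 0 (Nat.zero_le _)
  simp [path] at this
  omega

theorem killedExp_zero_of_nonneg (q : Measure ℤ) [IsProbabilityMeasure q] (a : ℝ) {z : ℤ}
    (hz : 0 ≤ z) : killedExp q a z 0 = ENNReal.ofReal (Real.exp (-(a * (z : ℝ)))) := by
  rw [killedExp_eq]
  have : ∀ w, killedWeight a 0 (path z w) = ENNReal.ofReal (Real.exp (-(a * (z : ℝ)))) := by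
    intro w
    rw [killedWeight, Set.indicator_of_mem]
    · simp [path]
    · intro k hk
      obtain rfl : k = 0 := by omega
      simpa [path] using hz
  simp [this]

/-- The Markov property at time one. -/
theorem killedExp_succ_of_nonneg (q : Measure ℤ) [IsProbabilityMeasure q] (a : ℝ) {z : ℤ}
    (hz : 0 ≤ z) (n : ℕ) :
    killedExp q a z (n + 1) = ∫⁻ w, killedExp q a (z + w) n ∂q := by
  have hm : Measurable fun w => killedWeight a (n + 1) (path z w) :=
    (measurable_killedWeight a (n + 1)).comp (measurable_path z)
  rw [killedExp_eq]
  conv_lhs => rw [← map_consStep q]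
  rw [lintegral_map hm measurable_consStep,
    lintegral_prod (fun p => killedWeight a (n + 1) (path z (consStep p)))
      (hm.comp measurable_consStep).aemeasurable]
  refine lintegral_congr fun w => ?_
  rw [killedExp_eq]
  refine lintegral_congr fun v => ?_
  have hmem : path z (consStep (w, v)) ∈ staysNonneg (n + 1)
      ↔ path (z + w) v ∈ staysNonneg n := by
    constructor
    · intro h k hk
      simpa only [path_consStep_succ] using h (k + 1) (by omega)
    · intro h k hk
      cases k with
      | zero => simpa only [path_consStep_zero] using hz
      | succ k => simpa only [path_consStep_succ] using h k (by omega)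
  by_cases h : path (z + w) v ∈ staysNonneg n
  · rw [killedWeight, killedWeight, Set.indicator_of_mem h, Set.indicator_of_mem (hmem.2 h),
      path_consStep_succ]
  · rw [killedWeight, killedWeight, Set.indicator_of_notMem h,
      Set.indicator_of_notMem (mt hmem.1 h)]

/-- A supersolution of the killed Poisson equation dominates the Green potential. -/
theorem tsum_killedExp_le (q : Measure ℤ) [IsProbabilityMeasure q] (a : ℝ) (H : ℤ → ℝ≥0∞)
    (hH : ∀ z : ℤ, 0 ≤ z →
      ENNReal.ofReal (Real.exp (-(a * (z : ℝ)))) + ∫⁻ w, H (z + w) ∂q ≤ H z) (z : ℤ) :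
    ∑' n, killedExp q a z n ≤ H z := by
  -- All `z` at once, since the induction hypothesis is used at `z + w`; for negative starting
  -- points the sums vanish.
  have key : ∀ N : ℕ, ∀ z : ℤ, ∑ n ∈ Finset.range N, killedExp q a z n ≤ H z := by
    intro N
    induction N with
    | zero => simp
    | succ N ih =>
      intro z
      rcases lt_or_ge z 0 with hz | hz
      · simp [killedExp_of_neg q a hz]
      · rw [Finset.sum_range_succ', killedExp_zero_of_nonneg q a hz, add_comm]
        refine le_trans (add_le_add le_rfl ?_) (hH z hz)
        simp only [killedExp_succ_of_nonneg q a hz]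
        rw [← lintegral_finsetSum _ fun n _ => measurable_from_top]
        exact lintegral_mono fun w => ih (z + w)
  exact ENNReal.tsum_le_of_sum_range_le fun N => key N z

/-! ### A bounded concave supersolution -/

/-- The concave profile `2 - 2^{-z}` on the nonnegative integers, extended by zero. -/
noncomputable def profile (z : ℤ) : ℝ :=
  if 0 ≤ z then 2 - (2 : ℝ) ^ (-z) else 0

theorem profile_of_nonneg {z : ℤ} (hz : 0 ≤ z) : profile z = 2 - (2 : ℝ) ^ (-z) := if_pos hz

theorem profile_of_neg {z : ℤ} (hz : z < 0) : profile z = 0 := if_neg (not_le.2 hz)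

theorem one_le_profile {z : ℤ} (hz : 0 ≤ z) : 1 ≤ profile z := by
  have : (2 : ℝ) ^ (-z) ≤ 1 := zpow_le_one_of_nonpos₀ (by norm_num) (by omega)
  rw [profile_of_nonneg hz]
  linarith

theorem profile_nonneg (z : ℤ) : 0 ≤ profile z := by
  rcases lt_or_ge z 0 with hz | hz
  · rw [profile_of_neg hz]
  · linarith [one_le_profile hz]

theorem profile_le_two (z : ℤ) : profile z ≤ 2 := by
  rcases lt_or_ge z 0 with hz | hz
  · rw [profile_of_neg hz]
    norm_num
  · rw [profile_of_nonneg hz]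
    have : (0 : ℝ) < (2 : ℝ) ^ (-z) := by positivity
    linarith

/-- Killing preserves the inequality: if one point is negative, the other contributes at most `2 ≤ 2
* profile z`. Otherwise it is `2^w + 2^{-w} ≥ 2`. -/
theorem profile_concave {z : ℤ} (hz : 0 ≤ z) (w : ℤ) :
    profile (z + w) + profile (z - w) ≤ 2 * profile z := by
  rcases lt_or_ge (z + w) 0 with h1 | h1
  · rw [profile_of_neg h1]
    linarith [profile_le_two (z - w), one_le_profile hz]
  rcases lt_or_ge (z - w) 0 with h2 | h2
  · rw [profile_of_neg h2]
    linarith [profile_le_two (z + w), one_le_profile hz]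
  rw [profile_of_nonneg hz, profile_of_nonneg h1, profile_of_nonneg h2]
  have e1 : (2 : ℝ) ^ (-(z + w)) = (2 : ℝ) ^ (-z) * ((2 : ℝ) ^ w)⁻¹ := by
    rw [neg_add, zpow_add₀ two_ne_zero, zpow_neg _ w]
  have e2 : (2 : ℝ) ^ (-(z - w)) = (2 : ℝ) ^ (-z) * (2 : ℝ) ^ w := by
    rw [neg_sub, sub_eq_neg_add, zpow_add₀ two_ne_zero]
  have hp : (0 : ℝ) < (2 : ℝ) ^ (-z) := by positivity
  have hw : (0 : ℝ) < (2 : ℝ) ^ w := by positivity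
  have h2 : 2 ≤ ((2 : ℝ) ^ w)⁻¹ + (2 : ℝ) ^ w := by
    have h3 := mul_inv_cancel₀ hw.ne'
    nlinarith [sq_nonneg ((2 : ℝ) ^ w - 1), inv_pos.2 hw, sq_nonneg (((2 : ℝ) ^ w)⁻¹ - 1),
      sq_nonneg (((2 : ℝ) ^ w)⁻¹ - (2 : ℝ) ^ w)]
  rw [e1, e2]
  nlinarith

/-- Equality in fact holds, also at `z = 0`, where the killed neighbour contributes `0`. -/
theorem profile_concave_one {z : ℤ} (hz : 0 ≤ z) :
    profile (z + 1) + profile (z - 1) + (2 : ℝ) ^ (-z) / 2 ≤ 2 * profile z := by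
  have e1 : (2 : ℝ) ^ (-(z + 1)) = (2 : ℝ) ^ (-z) / 2 := by
    rw [neg_add, zpow_add₀ two_ne_zero, zpow_neg_one]
    ring
  rcases hz.eq_or_lt with rfl | h
  · rw [profile_of_neg (z := 0 - 1) (by norm_num), profile_of_nonneg le_rfl,
      profile_of_nonneg (z := 0 + 1) (by norm_num), e1]
    norm_num
  · have e2 : (2 : ℝ) ^ (-(z - 1)) = (2 : ℝ) ^ (-z) * 2 := by
      rw [neg_sub, sub_eq_neg_add, zpow_add₀ two_ne_zero, zpow_one]
    rw [profile_of_nonneg hz, profile_of_nonneg (z := z + 1) (by omega),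
      profile_of_nonneg (z := z - 1) (by omega), e1, e2]
    linarith

theorem integrable_profile (q : Measure ℤ) [IsProbabilityMeasure q] (f : ℤ → ℤ) :
    Integrable (fun w => profile (f w)) q := by
  refine Integrable.of_bound (C := 2) measurable_from_top.aestronglyMeasurable
    (Eventually.of_forall fun w => ?_)
  rw [Real.norm_of_nonneg (profile_nonneg _)]
  exact profile_le_two _

theorem integral_profile_add_le (q : Measure ℤ) [IsProbabilityMeasure q]
    (hq : ∀ z : ℤ, q.real {-z} = q.real {z}) {z : ℤ} (hz : 0 ≤ z) :
    ∫ w, profile (z + w) ∂q + q.real {1} * (2 : ℝ) ^ (-z) / 4 ≤ profile z := by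
  have hneg : q.map (fun w => -w) = q := by
    refine Measure.ext_of_singleton fun w => ?_
    rw [Measure.map_apply measurable_from_top (MeasurableSet.singleton w)]
    have : (fun w : ℤ => -w) ⁻¹' {w} = {-w} := by
      ext v
      simp
    rw [this]
    exact (measureReal_eq_measureReal_iff).1 (hq w)
  have hrefl : ∫ w, profile (z - w) ∂q = ∫ w, profile (z + w) ∂q := by
    conv_rhs => rw [← hneg]
    rw [integral_map measurable_from_top.aemeasurable measurable_from_top.aestronglyMeasurable]
    rfl
  have hi1 := integrable_profile q fun w => z + w
  have hi2 := integrable_profile q fun w => z - w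
  have hi : Integrable (fun w => profile (z + w) + profile (z - w)) q := hi1.add hi2
  -- The concavity defect is nonnegative for every `w`; only its value at `w = 1` is kept.
  have hle : ∫ w, ({1} : Set ℤ).indicator (fun _ => (2 : ℝ) ^ (-z) / 2) w ∂q
      ≤ ∫ w, (2 * profile z - (profile (z + w) + profile (z - w))) ∂q := by
    refine integral_mono ((integrable_const _).indicator (MeasurableSet.singleton 1))
      ((integrable_const _).sub hi) fun w => ?_
    by_cases hw : w = 1
    · subst hw
      simp only [Set.indicator_of_mem (Set.mem_singleton (1 : ℤ))]
      linarith [profile_concave_one hz]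
    · rw [Set.indicator_of_notMem (by simpa using hw)]
      linarith [profile_concave hz w]
  rw [integral_indicator_const _ (MeasurableSet.singleton 1),
    integral_sub (integrable_const _) hi, integral_add hi1 hi2, hrefl,
    integral_const, probReal_univ, one_smul, smul_eq_mul] at hle
  linarith

/-- For a symmetric walk the killed potential is of the order of the inverse rate of unit
steps. -/
theorem supSum_le (q : Measure ℤ) [IsProbabilityMeasure q]
    (hq : ∀ z : ℤ, q.real {-z} = q.real {z}) (h1 : 0 < q.real {1}) {a : ℝ}
    (ha : Real.log 2 ≤ a) : supSum q a ≤ ENNReal.ofReal (8 / q.real {1}) := by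
  set K : ℝ := 4 / q.real {1} with hK
  have hKpos : 0 < K := by positivity
  refine iSup_le fun m => ?_
  refine (tsum_killedExp_le q a (fun z => ENNReal.ofReal (K * profile z)) ?_ m).trans ?_
  · intro z hz
    rw [← ofReal_integral_eq_lintegral_ofReal ((integrable_profile q _).const_mul K)
      (Eventually.of_forall fun w => mul_nonneg hKpos.le (profile_nonneg _)),
      ← ENNReal.ofReal_add (Real.exp_pos _).le
        (integral_nonneg fun w => mul_nonneg hKpos.le (profile_nonneg _))]
    refine ENNReal.ofReal_le_ofReal ?_
    rw [integral_const_mul]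
    have hexp : Real.exp (-(a * (z : ℝ))) ≤ (2 : ℝ) ^ (-z) := by
      rw [← Real.rpow_intCast, Real.rpow_def_of_pos two_pos]
      refine Real.exp_le_exp.2 ?_
      have : (0 : ℝ) ≤ z := by exact_mod_cast hz
      push_cast
      nlinarith
    have h2 := mul_le_mul_of_nonneg_left (integral_profile_add_le q hq hz) hKpos.le
    have h3 : K * (q.real {1} * (2 : ℝ) ^ (-z) / 4) = (2 : ℝ) ^ (-z) := by
      rw [hK]
      field_simp
    linarith
  · refine ENNReal.ofReal_le_ofReal ?_
    calc K * profile m ≤ K * 2 := mul_le_mul_of_nonneg_left (profile_le_two _) hKpos.le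
      _ = 8 / q.real {1} := by rw [hK]; ring

/-! ### Unit steps dominate, and the limit -/

/-- If long jumps are geometrically rare, then unit steps carry a fixed fraction of the
probability of moving. -/
theorem moveProb_le_four_mul (q : Measure ℤ) [IsProbabilityMeasure q]
    (hq : ∀ z : ℤ, q.real {-z} = q.real {z})
    (htail : ∀ z : ℤ, z ≠ 0 → z ≠ 1 → z ≠ -1 →
      q.real {z} ≤ moveProb q * (1 / 4 : ℝ) ^ z.natAbs) :
    moveProb q ≤ 4 * q.real {1} := by
  have hp0 : 0 ≤ moveProb q := sub_nonneg.2 measureReal_le_one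
  have hcompl : moveProb q = q.real {0}ᶜ := by
    rw [probReal_compl_eq_one_sub (MeasurableSet.singleton 0), moveProb]
  let S : ℕ → Set ℤ := fun n => {(n : ℤ) + 2} ∪ {-((n : ℤ) + 2)}
  have hcover : ({0}ᶜ : Set ℤ) ⊆ ({1} ∪ {-1}) ∪ ⋃ n, S n := by
    intro z hz
    have hz0 : z ≠ 0 := hz
    by_cases h : z = 1 ∨ z = -1
    · exact Or.inl h
    · refine Or.inr (Set.mem_iUnion.2 ⟨z.natAbs - 2, ?_⟩)
      simp only [S, Set.mem_union, Set.mem_singleton_iff]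
      omega
  have hS : ∀ n, q.real (S n) ≤ moveProb q / 8 * (1 / 4 : ℝ) ^ n := by
    intro n
    have e : ∀ z : ℤ, z.natAbs = n + 2 →
        q.real {z} ≤ moveProb q / 16 * (1 / 4 : ℝ) ^ n := by
      intro z hz
      have := htail z (by omega) (by omega) (by omega)
      rw [hz, pow_add] at this
      linarith
    have := measureReal_union_le (μ := q) {(n : ℤ) + 2} {-((n : ℤ) + 2)}
    linarith [e ((n : ℤ) + 2) (by omega), e (-((n : ℤ) + 2)) (by omega)]
  have hgeom : HasSum (fun n : ℕ => moveProb q / 8 * (1 / 4 : ℝ) ^ n)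
      (moveProb q / 8 * (1 - 1 / 4 : ℝ)⁻¹) :=
    (hasSum_geometric_of_lt_one (by norm_num) (by norm_num)).mul_left _
  -- Long jumps carry at most `p / 6`, so `p ≤ 2 q{1} + p / 6`, which is stronger than needed.
  have hU : q.real (⋃ n, S n) ≤ moveProb q / 6 := by
    refine ENNReal.toReal_le_of_le_ofReal (by positivity) ?_
    refine (measure_iUnion_le S).trans ?_
    have : moveProb q / 6 = ∑' n : ℕ, moveProb q / 8 * (1 / 4 : ℝ) ^ n := by
      rw [hgeom.tsum_eq]
      ring
    rw [this, ENNReal.ofReal_tsum_of_nonneg (fun n => by positivity) hgeom.summable]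
    refine ENNReal.tsum_le_tsum fun n => ?_
    rw [← ofReal_measureReal]
    exact ENNReal.ofReal_le_ofReal (hS n)
  have h1 := measureReal_mono (μ := q) hcover
  have h2 := measureReal_union_le (μ := q) ({1} ∪ {-1}) (⋃ n, S n)
  have h3 := measureReal_union_le (μ := q) {1} {-1}
  have h4 := hq 1
  linarith

end EffectiveWalk

open EffectiveWalk in
theorem EffectiveWalk.IsEffectiveStepLaw.exists_supSum_le {ν : ℝ} (hν : 0 < ν)
    {q : ℝ → Measure ℤ} [∀ β, IsProbabilityMeasure (q β)] (hq : IsEffectiveStepLaw ν q) :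
    ∃ C : ℝ, ∀ᶠ β in atTop, supSum (q β) (ν * β) ≤ ENNReal.ofReal (C * Real.exp β) := by
  obtain ⟨c, hc, hbound⟩ := hq.moveProb_isTheta.2.exists_pos
  -- From `e^{-β} ≤ c p ≤ 4 c q{1}`, one gets `8 / q{1} ≤ 32 c e^β`.
  refine ⟨32 * c, ?_⟩
  -- `log 4` makes the tail at most `p 4^{-|z|}`, and exceeds the `log 2` required by `supSum_le`.
  have hlarge : ∀ᶠ β : ℝ in atTop, Real.log 4 ≤ ν * β :=
    (tendsto_id.const_mul_atTop hν).eventually_ge_atTop _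
  filter_upwards [hq.symmetric, hq.tail, hbound.bound, hlarge] with β hsymm htail hp hβ
  have hp0 : 0 ≤ moveProb (q β) := sub_nonneg.2 measureReal_le_one
  rw [Real.norm_of_nonneg (Real.exp_pos _).le, Real.norm_of_nonneg hp0] at hp
  have hmove : moveProb (q β) ≤ 4 * (q β).real {1} := by
    refine moveProb_le_four_mul (q β) hsymm fun z h0 h1 h2 => ?_
    refine (htail z h0 h1 h2).trans (mul_le_mul_of_nonneg_left ?_ hp0)
    have : ((1 / 4 : ℝ)) ^ z.natAbs = Real.exp (-(Real.log 4 * |(z : ℝ)|)) := by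
      rw [← Real.rpow_natCast, Real.rpow_def_of_pos (by norm_num), Nat.cast_natAbs, one_div,
        Real.log_inv]
      push_cast
      ring_nf
    rw [this]
    exact Real.exp_le_exp.2 (neg_le_neg (mul_le_mul_of_nonneg_right hβ (abs_nonneg _)))
  have hle : Real.exp (-β) ≤ 4 * c * (q β).real {1} := by nlinarith
  have h1 : 0 < (q β).real {1} := by
    have := (Real.exp_pos (-β)).trans_le hle
    exact pos_of_mul_pos_right this (by positivity)
  refine (supSum_le (q β) hsymm h1 (le_trans ?_ hβ)).trans (ENNReal.ofReal_le_ofReal ?_)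
  · exact Real.log_le_log two_pos (by norm_num)
  · rw [div_le_iff₀ h1]
    have h5 : Real.exp β * Real.exp (-β) = 1 := by rw [← Real.exp_add]; simp
    have h6 := mul_le_mul_of_nonneg_left hle (Real.exp_pos β).le
    linarith

theorem mainTheorem10 (ν χ : ℝ) (hν : 0 < ν) (hχ : 1 / 2 < χ)
    (q : ℝ → Measure ℤ) [∀ β, IsProbabilityMeasure (q β)]
    (hq : EffectiveWalk.IsEffectiveStepLaw ν q) :
    Tendsto (fun β : ℝ =>
        ENNReal.ofReal (Real.exp (-(2 * χ * β))) * EffectiveWalk.supSum (q β) (ν * β))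
      atTop (𝓝 0) ∧
    ∀ c₁ : ℝ≥0, ∀ᶠ β : ℝ in atTop,
      (c₁ : ℝ≥0∞) * ENNReal.ofReal (Real.exp (-(2 * χ * β))) *
        EffectiveWalk.supSum (q β) (ν * β) < 1 := by
  have hlim : Tendsto (fun β : ℝ =>
      ENNReal.ofReal (Real.exp (-(2 * χ * β))) * EffectiveWalk.supSum (q β) (ν * β))
      atTop (𝓝 0) := by
    obtain ⟨C, hC⟩ := hq.exists_supSum_le hν
    have hdecay : Tendsto (fun β : ℝ => C * Real.exp (-((2 * χ - 1) * β))) atTop (𝓝 0) := by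
      have h : Tendsto (fun β : ℝ => (2 * χ - 1) * β) atTop atTop :=
        tendsto_id.const_mul_atTop (by linarith)
      simpa using (Real.tendsto_exp_neg_atTop_nhds_zero.comp h).const_mul C
    have hdecay' := ENNReal.tendsto_ofReal hdecay
    rw [ENNReal.ofReal_zero] at hdecay'
    refine tendsto_of_tendsto_of_tendsto_of_le_of_le' tendsto_const_nhds hdecay'
      (Eventually.of_forall fun _ => zero_le) ?_
    filter_upwards [hC] with β hβ
    refine (mul_le_mul_right hβ _).trans_eq ?_
    rw [← ENNReal.ofReal_mul (Real.exp_pos _).le, mul_left_comm, ← Real.exp_add]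
    ring_nf
  refine ⟨hlim, fun c₁ => ?_⟩
  have h := ENNReal.Tendsto.const_mul (a := (c₁ : ℝ≥0∞)) hlim (Or.inr ENNReal.coe_ne_top)
  rw [mul_zero] at h
  filter_upwards [h.eventually_lt_const one_pos] with β hβ
  rwa [mul_assoc]
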